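/- Let $d\ge 2$. A *$d$-ary plane tree* is either empty or a root with $d$ subtrees, linearly ordered, each a (possibly empty) $d$-ary plane tree; an edge has *type $i$* if it joins a vertex to the root of its $i$-th subtree. For a vertex $u$ let $\chi(u)$ be the set of $i\in\{1,\dots,d\}$ for which the $i$-th subtree of $u$ is nonempty. Contracting an edge of type $i$ from $u$ to its child $v$ is *legal* if every element of $\chi(u)\setminus\{i\}$ is smaller than every element of $\chi(v)$ or larger than every element of $\chi(v)$; after the contraction the subtrees of $v$, and the subtrees of $u$ other than the $i$-th, keep their positions. A tree $\mathcal T$ *noncontiguously contains* $T$ if $T$ arises from $\mathcal T$ by a (possibly empty) sequence of legal contractions. Let $N^{\mathrm{non}}_{d\text{-ary}}(k)$ be the minimum number of vertices of a $d$-ary plane tree that noncontiguously contains all $d$-ary plane trees with $k$ vertices. *Gluing* $T'$ to a vertex means identifying the root of $T'$ with that vertex. The *$d$-crescent* is the path with $d$ edges, of types $1,2,\dots,d$ from top to bottom. The *$d$-vertebra* is a $d$-crescent (its leaf is the *center leaf*) to which two paths are glued: a path with edge types $1,\dots,d-1$ at its vertex of depth $1$ (its lowest vertex is the *left leaf*),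 and a path with edge types $2,\dots,d$ at its root (its lowest vertex is the *right leaf*). The *$m$-th $d$-spine* consists of a $d$-crescent followed by $m$ $d$-vertebrae, the first glued to the leaf of the crescent and each later one to the center leaf of the previous one; the vertebrae are numbered from top to bottom. Define $\xi_d(k)$, $k\ge1$, recursively: $\xi_d(1)$ is a single vertex, $\xi_d(2)$ is the $d$-crescent, and $\xi_d(3)$ is the $d$-crescent whose leaf is given $d$ children, one in each position. For $k\ge4$ put $h=\lfloor k/2\rfloor$ and take the $(h-1)$-th $d$-spine if $d=2$, the $h$-th $d$-spine if $d>2$, and glue: - $\xi_d(i)$ to the left leaf and to the right leaf of the $i$-th vertebra, for $1\le i\le h-2$; - $\xi_d(h-1)$ to the right leaf and $\xi_d(\lceil k/2\rceil-1)$ to the left leaf of the $(h-1)$-th vertebra; - $\xi_d(\lceil k/2\rceil)$ to the center leaf of the lowest vertebra; - if $d>2$, also $\xi_d(\lfloor (k+1)/4\rfloor)$ to the left leaf and to the right leaf of the $h$-th vertebra. Let $M_d(k)$ be the number of vertices of $\xi_d(k)$. Then for every fixed $d\ge2$ and all $k\ge1$, $$N^{\mathrm{non}}_{d\text{-ary}}(k)\le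 M_d(k)=k^{\frac12\log_2(k)\,(1+o(1))},$$ where $o(1)$ denotes a function of $k$ (depending on $d$) that tends to $0$ as $k\to\infty$. -/

import Mathlib

/-- A `d`-ary plane tree: either empty, or a root with `d` linearly ordered subtrees, each of which
is a (possibly empty) `d`-ary plane tree. The edge from a vertex to the root of its subtree with
index `i : Fin d` is the edge of type `i + 1`. -/
inductive DAryTree (d : ℕ) : Type
  | empty : DAryTree d
  | node (c : Fin d → DAryTree d) : DAryTree d

namespace DAryTree

/-- The number of vertices. -/
def size {d : ℕ} : DAryTree d → ℕ
  | empty => 0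
  | node c => 1 + ∑ i, (c i).size

/-- The children of the root after contracting the edge of type `i` between a root with subtrees `c`
and a child with subtrees `c'`: the subtrees of the child keep their positions, and so do all
subtrees of the root other than the `i`-th. -/
def mergeChildren {d : ℕ} (c : Fin d → DAryTree d) (i : Fin d) (c' : Fin d → DAryTree d) :
    Fin d → DAryTree d := fun j =>
  match c' j with
  | empty => if j = i then empty else c j
  | node e => node e

/-- The contraction of the `i`-th edge below a vertex `u` with subtrees `c`, whose lower endpoint `v`
has subtrees `c'`, is legal: every `j ≠ i` in `χ(u)` is smaller than all elements of `χ(v)` or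
larger than all elements of `χ(v)`. -/
def IsLegal {d : ℕ} (c : Fin d → DAryTree d) (i : Fin d) (c' : Fin d → DAryTree d) : Prop :=
  ∀ j, j ≠ i → c j ≠ empty →
    (∀ b, c' b ≠ empty → j < b) ∨ (∀ b, c' b ≠ empty → b < j)

/-- `Contract T S`: the tree `S` is obtained from `T` by one legal contraction of an edge
(either an edge at the root, or an edge inside one of the subtrees). -/
inductive Contract {d : ℕ} : DAryTree d → DAryTree d → Prop
  | root (c : Fin d → DAryTree d) (i : Fin d) (c' : Fin d → DAryTree d) (hi : c i = node c')
      (legal : IsLegal c i c') : Contract (node c) (node (mergeChildren c i c'))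
  | sub (c : Fin d → DAryTree d) (i : Fin d) (t : DAryTree d) (h : Contract (c i) t) :
      Contract (node c) (node (Function.update c i t))

/-- `T` noncontiguously contains `S`. -/
def NonContains {d : ℕ} (T S : DAryTree d) : Prop := Relation.ReflTransGen Contract T S

/-- `T` is a noncontiguous `k`-universal `d`-ary plane tree. -/
def IsNonUniversal {d : ℕ} (k : ℕ) (T : DAryTree d) : Prop :=
  ∀ S : DAryTree d, S.size = k → NonContains T S

/-- The minimum number of vertices of a noncontiguous `k`-universal `d`-ary plane tree
(it would be `⊤` if there were no such tree). -/
noncomputable def nNon (d k : ℕ) : ℕ∞ :=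
  ⨅ (T : DAryTree d) (_ : IsNonUniversal k T), (T.size : ℕ∞)

/-- The tree with one vertex. -/
def single {d : ℕ} : DAryTree d := node fun _ => empty

/-- The path whose edges have, from top to bottom, the types in the given list, with `t` glued to its
lowest vertex. -/
def path {d : ℕ} : List (Fin d) → DAryTree d → DAryTree d
  | [], t => t
  | i :: l, t => node fun j => if j = i then path l t else empty

/-- Identify the roots of two trees (used only when no type occurs at both roots). -/
def glueRoot {d : ℕ} : DAryTree d → DAryTree d → DAryTree d
  | empty, t => t
  | node c, empty => node c
  | node c, node c' => node fun j =>
      match c j with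
      | empty => c' j
      | node e => node e

/-- The `d`-crescent (the path with edge types `1, …, d`), with `t` glued to its leaf. -/
def crescent {d : ℕ} (t : DAryTree d) : DAryTree d := path (List.finRange d) t

/-- The `d`-vertebra with `L`, `C`, `R` glued to its left, center and right leaf. The second of the
three crescents is cut at its vertex of depth `1`, whose edge to the root has type `1`; the
first crescent, without its lowest vertex (edge types `1, …, d - 1`), is attached to that vertex, and
the third one, without its root (edge types `2, …, d`), is attached to the root. -/
def vertebra {d : ℕ} (L C R : DAryTree d) : DAryTree d :=
  glueRoot
    (path ((List.finRange d).take 1)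
      (glueRoot (path (List.finRange d).dropLast L) (path (List.finRange d).tail C)))
    (path (List.finRange d).tail R)

/-- The `m`-th `d`-spine with trees glued to its leaves: the list contains, for each of the `m`
vertebrae from the highest to the lowest, the trees glued to its left and right leaf, and `t` is
glued to the center leaf of the lowest vertebra. -/
def spine {d : ℕ} (l : List (DAryTree d × DAryTree d)) (t : DAryTree d) : DAryTree d :=
  crescent (l.foldr (fun p s => vertebra p.1 s p.2) t)

/-- The trees `ξ_d(k)`, for `d ≥ 2` and `k ≥ 1` (the value at `k = 0` is irrelevant). Note that
`(k + 1) / 2` is the ceiling of `k / 2`. -/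
def xi (d : ℕ) : ℕ → DAryTree d
  | 0 => empty
  | 1 => single
  | 2 => crescent single
  | 3 => crescent (node fun _ => single)
  | n + 4 =>
    let k := n + 4
    spine
      (List.ofFn (fun i : Fin (k / 2 - 2) => (xi d (i.val + 1), xi d (i.val + 1)))
        ++ [(xi d ((k + 1) / 2 - 1), xi d (k / 2 - 1))]
        ++ if d = 2 then [] else [(xi d ((k + 1) / 4), xi d ((k + 1) / 4))])
      (xi d ((k + 1) / 2))
  termination_by k => k
  decreasing_by all_goals omega

/-- The number of vertices of `ξ_d(k)`. -/
def xiSize (d k : ℕ) : ℕ := (xi d k).size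

end DAryTree

/-! Universality. Contracting a crescent keeps at most one edge, of any prescribed type. A vertebra
can therefore supply the leftmost or the rightmost child subtree of a vertex from its left or right
leaf, at the required position, while its center leaf supplies the rest (`vertebra_left`,
`vertebra_right`); it can also be skipped (`vertebra_skip`). Given a tree whose root has several
children, let m be the size of the smaller of the two extreme child subtrees. Skipping m - 1
vertebrae gives leaves large enough for that subtree, and the remainder has lost m vertices at a
cost of m vertebrae. So the part of the spine below the first n vertebrae has to deal only with
trees of at most k - n vertices, and once at most k - h vertices remain the center leaf suffices.
This induction is `covers_crescent_of_chain`, and `covers_xi` feeds it the recursion.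

Growth. About k/2 pairs of subtrees ξ(i), with i up to about k/2, are glued to the spine, so M(k) is
at most 4dk times a bound for M up to ⌈k/2⌉, and at least a constant times k times a lower bound for
M on (k/ρ, k/2 - 2], for any fixed ρ > 2. With y = log₂ k, one step of these recursions shifts y by
about 1 and adds y + O(1) to log₂ M, so log₂ M is asymptotic to y²/2. -/

namespace DAryTree

/-! ### Calculus of legal contractions -/

variable {d : ℕ}

/-- The children of a root whose only child, in position `i`, is the root of `t`. -/
def only (i : Fin d) (t : DAryTree d) : Fin d → DAryTree d := fun j => if j = i then t else empty

@[simp] lemma only_self (i : Fin d) (t : DAryTree d) : only i t i = t := by simp [only]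

lemma only_of_ne {i j : Fin d} (h : j ≠ i) (t : DAryTree d) : only i t j = empty := by
  simp [only, h]

lemma eq_of_only_ne_empty {i j : Fin d} {t : DAryTree d} (h : only i t j ≠ empty) : j = i := by
  by_contra hj
  exact h (only_of_ne hj t)

lemma path_cons (i : Fin d) (l : List (Fin d)) (t : DAryTree d) :
    path (i :: l) t = node (only i (path l t)) := rfl

lemma exists_eq_node {t : DAryTree d} (h : t ≠ empty) : ∃ c, t = node c := by
  cases t with
  | empty => exact absurd rfl h
  | node c => exact ⟨c, rfl⟩

lemma path_ne_empty (l : List (Fin d)) {t : DAryTree d} (h : t ≠ empty) : path l t ≠ empty := by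
  cases l with
  | nil => exact h
  | cons i l => simp [path_cons]

namespace NonContains

lemma refl (t : DAryTree d) : NonContains t t := Relation.ReflTransGen.refl

lemma trans {r s t : DAryTree d} (h₁ : NonContains r s) (h₂ : NonContains s t) :
    NonContains r t := Relation.ReflTransGen.trans h₁ h₂

lemma of_eq {s t : DAryTree d} (h : s = t) : NonContains s t := h ▸ refl s

lemma ne_empty {s t : DAryTree d} (h : NonContains s t) (ht : t ≠ empty) : s ≠ empty := by
  rintro rfl
  rcases Relation.ReflTransGen.cases_head h with h | ⟨u, hu, -⟩
  · exact ht h.symm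
  · cases hu

lemma update {c : Fin d → DAryTree d} {i : Fin d} {t : DAryTree d} (h : NonContains (c i) t) :
    NonContains (node c) (node (Function.update c i t)) := by
  have key : ∀ s t : DAryTree d, Contract s t →
      Contract (node (Function.update c i s)) (node (Function.update c i t)) := by
    intro s t hst
    have := Contract.sub (Function.update c i s) i t (by simpa using hst)
    simpa using this
  have := Relation.ReflTransGen.lift (fun s => node (Function.update c i s)) key _ _ h
  simpa [NonContains, Function.onFun] using this

lemma merge {c : Fin d → DAryTree d} {i : Fin d} {e : Fin d → DAryTree d}
    (h : NonContains (c i) (node e)) (legal : IsLegal c i e) :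
    NonContains (node c) (node (mergeChildren c i e)) := by
  refine (update h).trans ?_
  have hl : IsLegal (Function.update c i (node e)) i e := by
    intro j hj hc
    exact legal j hj (by simpa [hj] using hc)
  have := Contract.root (Function.update c i (node e)) i e (by simp) hl
  have he : mergeChildren (Function.update c i (node e)) i e = mergeChildren c i e := by
    funext j
    by_cases hj : j = i <;> simp [mergeChildren, hj]
  rw [he] at this
  exact Relation.ReflTransGen.single this

/-- A leaf can always be deleted: its χ is empty, so legality is vacuous. -/
lemma update_empty_of_single {c : Fin d → DAryTree d} {i : Fin d}
    (h : c i = empty ∨ NonContains (c i) single) :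
    NonContains (node c) (node (Function.update c i empty)) := by
  rcases h with h | h
  · exact of_eq (by rw [← h]; simp)
  · refine (merge (e := fun _ => empty) h ?_).trans (of_eq ?_)
    · intro j _ _
      left
      intro b hb
      exact absurd rfl hb
    · congr 1
      funext j
      by_cases hj : j = i
      · subst hj; simp [mergeChildren]
      · simp [mergeChildren, hj]

lemma single_of_ne_empty {t : DAryTree d} (h : t ≠ empty) : NonContains t single := by
  induction t with
  | empty => exact absurd rfl h
  | node c ih =>
    have key : ∀ S : Finset (Fin d), NonContains (node c) (node fun j => if j ∈ S then empty else c j) := by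
      intro S
      induction S using Finset.induction_on with
      | empty => exact of_eq (by simp)
      | insert i S hi hS =>
        refine hS.trans ?_
        refine (update_empty_of_single (i := i) ?_).trans (of_eq ?_)
        · simp only [hi, if_false]
          by_cases hc : c i = empty
          · exact Or.inl hc
          · exact Or.inr (ih i hc)
        · congr 1
          funext j
          by_cases hj : j = i <;> simp [hj]
    exact (key Finset.univ).trans (of_eq (by simp [single]))

/-- Contractions inside distinct subtrees do not interact, and an unwanted subtree shrinks to one
vertex and is then deleted. The positions are treated one at a time. -/
lemma children {c c' : Fin d → DAryTree d} (h : ∀ j, c' j = empty ∨ NonContains (c j) (c' j)) :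
    NonContains (node c) (node c') := by
  have key : ∀ S : Finset (Fin d), NonContains (node c) (node fun j => if j ∈ S then c' j else c j) := by
    intro S
    induction S using Finset.induction_on with
    | empty => exact of_eq (by simp)
    | insert i S hi hS =>
      refine hS.trans ?_
      refine trans (s := node (Function.update (fun j => if j ∈ S then c' j else c j) i (c' i)))
        ?_ (of_eq ?_)
      · rcases h i with h | h
        · rw [h]
          refine update_empty_of_single ?_
          simp only [hi, if_false]
          by_cases hc : c i = empty
          · exact Or.inl hc
          · exact Or.inr (single_of_ne_empty hc)
        · exact update (by simpa [hi] using h)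
      · congr 1
        funext j
        by_cases hj : j = i
        · subst hj; simp
        · simp [hj]
  exact (key Finset.univ).trans (of_eq (by simp))

lemma of_only {i : Fin d} {t : DAryTree d} (h : t ≠ empty) : NonContains (node (only i t)) t := by
  obtain ⟨e, rfl⟩ := exists_eq_node h
  refine (merge (i := i) (e := e) (of_eq (by simp)) ?_).trans (of_eq ?_)
  · intro j hj hc
    exact absurd (only_of_ne hj _) hc
  · congr 1
    funext j
    by_cases hj : j = i
    · subst hj
      cases he : e j <;> simp [mergeChildren, he]
    · cases he : e j <;> simp [mergeChildren, he, hj, only]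

lemma of_path (l : List (Fin d)) {t : DAryTree d} (h : t ≠ empty) : NonContains (path l t) t := by
  induction l with
  | nil => exact refl t
  | cons i l ih => exact (of_only (path_ne_empty l h)).trans ih

lemma only_mono {i : Fin d} {s t : DAryTree d} (h : NonContains s t) :
    NonContains (node (only i s)) (node (only i t)) := by
  refine children fun j => ?_
  by_cases hj : j = i
  · subst hj; simpa using Or.inr h
  · exact Or.inl (only_of_ne hj _)

/-- Every contraction on a path is legal, so all edges except one of type `b` can be removed. -/
lemma path_only {l : List (Fin d)} {b : Fin d} (hb : b ∈ l) {t : DAryTree d} (h : t ≠ empty) :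
    NonContains (path l t) (node (only b t)) := by
  induction l with
  | nil => simp at hb
  | cons i l ih =>
    by_cases hi : b = i
    · subst hi
      exact only_mono (of_path l h)
    · exact (of_only (path_ne_empty l h)).trans (ih (by simpa [hi] using hb))

end NonContains

/-- The tree `C`, possibly with an edge above its root of a type in `l`, contains `node e`. -/
def Reaches (l : List (Fin d)) (C : DAryTree d) (e : Fin d → DAryTree d) : Prop :=
  NonContains C (node e) ∨ ∃ b ∈ l, ∃ t, t ≠ empty ∧ e = only b t ∧ NonContains C t

lemma Reaches.ne_empty {l : List (Fin d)} {C : DAryTree d} {e : Fin d → DAryTree d}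
    (h : Reaches l C e) : C ≠ empty := by
  rcases h with h | ⟨b, -, t, ht, -, h⟩
  · exact h.ne_empty (by simp)
  · exact h.ne_empty ht

lemma Reaches.path {l : List (Fin d)} {C : DAryTree d} {e : Fin d → DAryTree d}
    (h : Reaches l C e) : NonContains (path l C) (node e) := by
  have hC := h.ne_empty
  rcases h with h | ⟨b, hb, t, -, rfl, h⟩
  · exact (NonContains.of_path l hC).trans h
  · exact (NonContains.path_only hb hC).trans (NonContains.only_mono h)

/-- The branch below edge `i` is contracted into its root. If the one edge to be kept is `i` itself,
it stays in place; otherwise it comes from `l` and edge `i` is contracted last. -/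
lemma Reaches.branch {c : Fin d → DAryTree d} {i : Fin d} {l : List (Fin d)} {C : DAryTree d}
    {e : Fin d → DAryTree d} (hc : c i = DAryTree.path l C) (h : Reaches (i :: l) C e)
    (legal : IsLegal c i e) : NonContains (node c) (node (mergeChildren c i e)) := by
  have hC := h.ne_empty
  rcases h with h | ⟨b, hb, t, ht, rfl, h⟩
  · exact NonContains.merge (hc ▸ (NonContains.of_path l hC).trans h) legal
  · by_cases hi : b = i
    · subst hi
      refine (NonContains.update (i := b) (t := t) ?_).trans (.of_eq ?_)
      · rw [hc]
        exact (NonContains.of_path l hC).trans h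
      · congr 1
        funext j
        by_cases hj : j = b
        · subst hj
          cases t <;> simp [mergeChildren]
        · simp [mergeChildren, hj, only]
    · refine NonContains.merge ?_ legal
      rw [hc]
      exact (NonContains.path_only (by simpa [hi] using hb) hC).trans (NonContains.only_mono h)

/-! ### What one vertebra can supply -/

lemma exists_vertebra_eq (n : ℕ) : ∃ l₁ l₂ : List (Fin (n + 2)),
    (∀ a, a ≠ Fin.last (n + 1) → a ∈ 0 :: l₁) ∧ (∀ a, a ≠ 0 → a ∈ 1 :: l₂) ∧
    (∀ L C R : DAryTree (n + 2), vertebra L C R =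
      node fun j => if j = 0 then
          node fun j => if j = 0 then path l₁ L else if j = 1 then path l₂ C else empty
        else if j = 1 then path l₂ R else empty) := by
  have hf : List.finRange (n + 2) = 0 :: 1 :: (List.finRange n).map (Fin.succ ∘ Fin.succ) := by
    simp [List.finRange_succ]
  refine ⟨((1 : Fin (n + 2)) :: (List.finRange n).map (Fin.succ ∘ Fin.succ)).dropLast,
    (List.finRange n).map (Fin.succ ∘ Fin.succ), ?_, ?_, ?_⟩
  · intro a ha
    have : (0 : Fin (n + 2)) :: ((1 : Fin (n + 2)) ::
        (List.finRange n).map (Fin.succ ∘ Fin.succ)).dropLast = (List.finRange (n + 2)).dropLast := by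
      rw [hf]; simp
    rw [this, List.finRange_succ_last]
    simp only [List.dropLast_concat, List.mem_map, List.mem_finRange, true_and]
    exact ⟨a.castPred ha, by simp⟩
  · intro a ha
    have := List.mem_finRange a
    rw [hf] at this
    simpa [ha] using this
  · intro L C R
    have h1 : (List.finRange (n + 2)).take 1 = [0] := by rw [hf]; simp
    have h2 : (List.finRange (n + 2)).dropLast = 0 ::
      ((1 : Fin (n + 2)) :: (List.finRange n).map (Fin.succ ∘ Fin.succ)).dropLast := by
      rw [hf]; simp
    have h3 : (List.finRange (n + 2)).tail = 1 :: (List.finRange n).map (Fin.succ ∘ Fin.succ) := by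
      rw [hf]; simp
    unfold vertebra
    rw [h1, h2, h3]
    generalize ((1 : Fin (n + 2)) :: (List.finRange n).map (Fin.succ ∘ Fin.succ)).dropLast = l₁
    generalize (List.finRange n).map (Fin.succ ∘ Fin.succ) = l₂
    simp only [path, glueRoot]
    congr 1
    funext j
    by_cases hj : j = 0
    · subst hj
      simp only [if_true]
      congr 1
      funext j
      by_cases hj : j = 0
      · subst hj
        cases path l₁ L <;> simp
      · simp [hj]
    · simp [hj]

lemma mergeChildren_of_ne_empty {c e : Fin d → DAryTree d} {i j : Fin d} (h : e j ≠ empty) :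
    mergeChildren c i e j = e j := by
  obtain ⟨x, hx⟩ := exists_eq_node h
  simp [mergeChildren, hx]

lemma mergeChildren_of_empty {c e : Fin d → DAryTree d} {i j : Fin d} (h : e j = empty) :
    mergeChildren c i e j = if j = i then empty else c j := by
  simp [mergeChildren, h]

/-- The left path lacks only the last type, and the type `a` of a child with another child to its
right is never the last one. -/
lemma vertebra_left (hd : 2 ≤ d) {L C R s : DAryTree d} {e : Fin d → DAryTree d} {a b : Fin d}
    (hs : s ≠ empty) (hL : NonContains L s) (hC : Reaches (List.finRange d) C e)
    (ha : ∀ j, e j ≠ empty → a < j) (hb : e b ≠ empty) :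
    NonContains (vertebra L C R) (node (Function.update e a s)) := by
  obtain ⟨n, rfl⟩ := Nat.exists_eq_add_of_le' hd
  obtain ⟨l₁, l₂, h₁, h₂, h⟩ := exists_vertebra_eq n
  rw [h]
  set g : Fin (n + 2) → DAryTree (n + 2) :=
    fun j => if j = 0 then path l₁ L else if j = 1 then path l₂ C else empty with hg
  have hab := ha b hb
  have ha1 : ∀ j, e j ≠ empty → j ≠ 0 := fun j hj h0 => by
    subst h0; exact absurd (ha _ hj) (by simp)
  have he0 : e 0 = empty := by
    by_contra h0; exact ha1 0 h0 rfl
  -- Delete the right branch and contract the top edge, leaving the vertex of depth 1 with its left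
  -- and center branches.
  refine NonContains.trans (s := node g) ?_ ?_
  · refine NonContains.trans (s := node (only 0 (node g))) (NonContains.children fun j => ?_)
      (NonContains.of_only (by simp))
    by_cases hj : j = 0
    · subst hj; exact Or.inr (.of_eq (by simp))
    · exact Or.inl (only_of_ne hj _)
  have hC' : Reaches (1 :: l₂) C e := by
    rcases hC with h | ⟨b', -, t, ht, rfl, h⟩
    · exact Or.inl h
    · exact Or.inr ⟨b', h₂ b' (ha1 b' (by simpa using ht)), t, ht, rfl, h⟩
  -- The center comes first: the left branch still sits at index 0, to the left of everything in
  -- `e`. Moved to `a` first, it could collide with the center branch at index 1.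
  refine (Reaches.branch (i := 1) (l := l₂) (by simp [hg]) hC' ?_).trans ?_
  · intro j hj hgj
    have hj0 : j = 0 := by
      by_contra h0
      exact hgj (by simp [hg, h0, hj])
    subst hj0
    exact Or.inl fun b hb => Fin.pos_iff_ne_zero.2 (ha1 b hb)
  refine (Reaches.branch (i := 0) (l := l₁) (C := L) (e := only a s) ?_
    (Or.inr ⟨a, h₁ a (hab.trans_le (Fin.le_last b)).ne, s, hs, rfl, hL⟩) ?_).trans (.of_eq ?_)
  · rw [mergeChildren_of_empty he0]; simp [hg]
  · intro j hj hcj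
    right
    intro x hx
    rw [eq_of_only_ne_empty hx]
    apply ha
    intro hej
    rw [mergeChildren_of_empty hej] at hcj
    by_cases h1 : j = 1 <;> simp [hg, h1, hj] at hcj
  · congr 1
    funext j
    by_cases hj : j = a
    · subst hj
      rw [mergeChildren_of_ne_empty (by simpa using hs)]; simp
    · rw [mergeChildren_of_empty (only_of_ne hj _), Function.update_of_ne hj]
      by_cases hj0 : j = 0
      · subst hj0; simp [he0]
      · rw [if_neg hj0]
        by_cases hej : e j = empty
        · rw [mergeChildren_of_empty hej, hej]
          by_cases h1 : j = 1 <;> simp [hg, h1, hj0]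
        · rw [mergeChildren_of_ne_empty hej]

/-- Here the left branch is deleted and the right branch is contracted before the center: it must
leave index 1, which `e` may occupy, and move to `a`. -/
lemma vertebra_right (hd : 2 ≤ d) {L C R s : DAryTree d} {e : Fin d → DAryTree d} {a b : Fin d}
    (hs : s ≠ empty) (hR : NonContains R s) (hC : Reaches (List.finRange d) C e)
    (ha : ∀ j, e j ≠ empty → j < a) (hb : e b ≠ empty) :
    NonContains (vertebra L C R) (node (Function.update e a s)) := by
  obtain ⟨n, rfl⟩ := Nat.exists_eq_add_of_le' hd
  obtain ⟨l₁, l₂, h₁, h₂, h⟩ := exists_vertebra_eq n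
  rw [h]
  have ha0 : 0 < a := (Fin.zero_le b).trans_lt (ha b hb)
  set f : Fin (n + 2) → DAryTree (n + 2) :=
    fun j => if j = 0 then path (1 :: l₂) C else if j = 1 then path l₂ R else empty with hf
  refine NonContains.trans (s := node f) (NonContains.children fun j => ?_) ?_
  · right
    by_cases hj : j = 0
    · subst hj
      simp only [hf, if_true, path_cons]
      refine NonContains.children fun j => ?_
      by_cases hj : j = 1
      · subst hj; exact Or.inr (.of_eq (by simp))
      · exact Or.inl (only_of_ne hj _)
    · exact .of_eq (by simp [hf, hj])
  refine (Reaches.branch (i := 1) (l := l₂) (C := R) (e := only a s) (by simp [hf])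
    (Or.inr ⟨a, h₂ a ha0.ne', s, hs, rfl, hR⟩) ?_).trans ?_
  · intro j hj hfj
    have hj0 : j = 0 := by
      by_contra h0
      exact hfj (by simp [hf, h0, hj])
    subst hj0
    exact Or.inl fun x hx => by rwa [eq_of_only_ne_empty hx]
  have hC' : Reaches (0 :: 1 :: l₂) C e := by
    rcases hC with h | ⟨b', -, t, ht, rfl, h⟩
    · exact Or.inl h
    · refine Or.inr ⟨b', ?_, t, ht, rfl, h⟩
      by_cases hb' : b' = 0
      · simp [hb']
      · exact List.mem_cons_of_mem _ (h₂ b' hb')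
  have hne : ∀ j, j ≠ 0 → j ≠ a → mergeChildren f 1 (only a s) j = empty := by
    intro j hj hja
    rw [mergeChildren_of_empty (only_of_ne hja _)]
    by_cases h1 : j = 1 <;> simp [hf, hj, h1]
  refine (Reaches.branch (i := 0) (l := 1 :: l₂) ?_ hC' ?_).trans (.of_eq ?_)
  · rw [mergeChildren_of_empty (only_of_ne ha0.ne _)]; simp [hf]
  · intro j hj hcj
    right
    have : j = a := by
      by_contra hja
      exact hcj (hne j hj hja)
    subst this
    exact ha
  · congr 1
    funext j
    by_cases hj : j = a
    · subst hj
      have : e j = empty := by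
        by_contra h0; exact absurd (ha j h0) (lt_irrefl _)
      rw [mergeChildren_of_empty this, if_neg ha0.ne',
        mergeChildren_of_ne_empty (by simpa using hs)]; simp
    · rw [Function.update_of_ne hj]
      by_cases hej : e j = empty
      · rw [mergeChildren_of_empty hej, hej]
        by_cases hj0 : j = 0
        · simp [hj0]
        · rw [if_neg hj0, hne j hj0 hj]
      · rw [mergeChildren_of_ne_empty hej]

lemma vertebra_skip (hd : 2 ≤ d) {L C R : DAryTree d} {e : Fin d → DAryTree d}
    (hC : Reaches (List.finRange d) C e) : NonContains (vertebra L C R) (node e) := by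
  obtain ⟨n, rfl⟩ := Nat.exists_eq_add_of_le' hd
  obtain ⟨l₁, l₂, h₁, h₂, h⟩ := exists_vertebra_eq n
  rw [h]
  have hC' : Reaches (0 :: 1 :: l₂) C e := by
    rcases hC with h | ⟨b', -, t, ht, rfl, h⟩
    · exact Or.inl h
    · refine Or.inr ⟨b', ?_, t, ht, rfl, h⟩
      by_cases hb' : b' = 0
      · simp [hb']
      · exact List.mem_cons_of_mem _ (h₂ b' hb')
  refine NonContains.trans (s := path (0 :: 1 :: l₂) C) ?_ hC'.path
  rw [path_cons]
  refine NonContains.children fun j => ?_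
  by_cases hj : j = 0
  · subst hj
    simp only [only_self, if_true, path_cons]
    right
    refine NonContains.children fun j => ?_
    by_cases hj : j = 1
    · subst hj; exact Or.inr (.of_eq (by simp))
    · exact Or.inl (only_of_ne hj _)
  · exact Or.inl (only_of_ne hj _)

end DAryTree

/-! ### Universality of the trees ξ -/

namespace DAryTree

variable {d : ℕ}

lemma size_node (e : Fin d → DAryTree d) : (node e).size = 1 + ∑ i, (e i).size := rfl

lemma size_pos {t : DAryTree d} (h : t ≠ empty) : 1 ≤ t.size := by
  obtain ⟨e, rfl⟩ := exists_eq_node h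
  rw [size_node]; omega

lemma ne_empty_of_size_pos {t : DAryTree d} (h : 1 ≤ t.size) : t ≠ empty := by
  rintro rfl
  simp [size] at h

lemma size_update_empty (e : Fin d → DAryTree d) (a : Fin d) :
    (node (Function.update e a empty)).size + (e a).size = (node e).size := by
  simp only [size_node]
  rw [← Finset.add_sum_erase _ (fun i => (e i).size) (Finset.mem_univ a),
    ← Finset.add_sum_erase _ (fun i => (Function.update e a empty i).size) (Finset.mem_univ a)]
  rw [Finset.sum_congr rfl (g := fun i => (e i).size) fun i hi => by
    rw [Function.update_of_ne (Finset.ne_of_mem_erase hi)]]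
  simp [size]
  omega

lemma size_only (b : Fin d) (t : DAryTree d) : (node (only b t)).size = 1 + t.size := by
  rw [size_node, Finset.sum_eq_single b]
  · simp
  · intro j _ hj
    simp [only_of_ne hj, size]
  · simp

lemma size_child_le (e : Fin d → DAryTree d) (a : Fin d) : 1 + (e a).size ≤ (node e).size := by
  have := size_update_empty e a
  have := size_pos (t := node (Function.update e a empty)) (by simp)
  omega

lemma size_two_children_le (e : Fin d → DAryTree d) {a c : Fin d} (h : a ≠ c) :
    1 + (e a).size + (e c).size ≤ (node e).size := by
  have h1 := size_update_empty e a
  have h2 := size_child_le (Function.update e a empty) c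
  rw [Function.update_of_ne h.symm] at h2
  omega

/-- `T` noncontiguously contains all nonempty trees with at most `s` vertices. -/
def Covers (s : ℕ) (T : DAryTree d) : Prop := ∀ t, t ≠ empty → t.size ≤ s → NonContains T t

lemma Covers.mono {r s : ℕ} {T : DAryTree d} (h : Covers s T) (hr : r ≤ s) : Covers r T :=
  fun t ht hts => h t ht (hts.trans hr)

lemma exists_extreme_children {e : Fin d → DAryTree d} {j : Fin d} (hj : e j ≠ empty)
    (hs : ¬ ∃ b t, e = only b t) :
    ∃ a c, a < c ∧ e a ≠ empty ∧ e c ≠ empty ∧ ∀ i, e i ≠ empty → a ≤ i ∧ i ≤ c := by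
  classical
  set S : Finset (Fin d) := Finset.univ.filter fun i => e i ≠ empty with hS
  have hmem : ∀ i, i ∈ S ↔ e i ≠ empty := by simp [hS]
  have hne : S.Nonempty := ⟨j, (hmem j).2 hj⟩
  refine ⟨S.min' hne, S.max' hne, ?_, (hmem _).1 (S.min'_mem hne), (hmem _).1 (S.max'_mem hne),
    fun i hi => ⟨S.min'_le i ((hmem i).2 hi), S.le_max' i ((hmem i).2 hi)⟩⟩
  refine lt_of_le_of_ne (S.min'_le _ (S.max'_mem hne)) fun heq => hs ⟨S.min' hne, e (S.min' hne), ?_⟩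
  funext i
  by_cases hi : i = S.min' hne
  · subst hi; rw [only_self]
  · rw [only_of_ne hi]
    by_contra h
    have h1 := S.min'_le i ((hmem i).2 h)
    have h2 := S.le_max' i ((hmem i).2 h)
    rw [← heq] at h2
    exact hi (le_antisymm h2 h1)

lemma vertebra_peel (hd : 2 ≤ d) {L C R : DAryTree d} {e : Fin d → DAryTree d} {a c : Fin d}
    (hac : a < c) (ha : e a ≠ empty) (hc : e c ≠ empty)
    (hext : ∀ i, e i ≠ empty → a ≤ i ∧ i ≤ c)
    (h : ((e a).size ≤ (e c).size ∧ NonContains L (e a) ∧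
        Reaches (List.finRange d) C (Function.update e a empty)) ∨
      ((e c).size < (e a).size ∧ NonContains R (e c) ∧
        Reaches (List.finRange d) C (Function.update e c empty))) :
    NonContains (vertebra L C R) (node e) := by
  rcases h with ⟨-, hL, hC⟩ | ⟨-, hR, hC⟩
  · have := vertebra_left hd (R := R) (a := a) (b := c) ha hL hC ?_ ?_
    · simpa using this
    · intro j hj
      have hja : j ≠ a := by rintro rfl; simp at hj
      rw [Function.update_of_ne hja] at hj
      exact lt_of_le_of_ne (hext j hj).1 hja.symm
    · rwa [Function.update_of_ne hac.ne']
  · have := vertebra_right hd (L := L) (a := c) (b := a) hc hR hC ?_ ?_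
    · simpa using this
    · intro j hj
      have hja : j ≠ c := by rintro rfl; simp at hj
      rw [Function.update_of_ne hja] at hj
      exact lt_of_le_of_ne (hext j hj).2 hja
    · rwa [Function.update_of_ne hac.ne]

/-- A chain of `h - 1` vertebrae (`h` if `d ≠ 2`), whose side branches cover trees of the sizes
required in the construction of `xi`, together with the crescent above it, covers all trees with at
most `k` vertices. -/
lemma covers_crescent_of_chain (hd : 2 ≤ d) {h k : ℕ} (hh : 2 ≤ h) (hk : k = 2 * h ∨ k = 2 * h + 1)
    (V : ℕ → DAryTree d) (C : DAryTree d)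
    (hV : ∀ n < h - 1, ∃ L R, V n = vertebra L (V (n + 1)) R ∧ Covers (n + 1) L ∧
      Covers (n + 1) R ∧ (n + 2 = h → Covers (k - h - 1) L))
    (hC : Covers (k - h) C) (hV₂ : d = 2 → V (h - 1) = C)
    (hV₃ : d ≠ 2 → ∃ L R, V (h - 1) = vertebra L C R ∧ Covers ((k - h) / 2) L ∧
      Covers ((k - h) / 2) R) :
    Covers k (crescent (V 0)) := by
  have skip : ∀ m ≤ h - 1, ∀ n ≤ m, ∀ e, NonContains (V m) (node e) → NonContains (V n) (node e) := by
    intro m hm n hn e he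
    induction hn using Nat.decreasingInduction with
    | self => exact he
    | of_succ n hn ih =>
      obtain ⟨L, R, hVn, -⟩ := hV n (by omega)
      rw [hVn]
      exact vertebra_skip hd (Or.inl ih)
  have center : ∀ n ≤ h - 1, ∀ e, (node e).size ≤ k - h → NonContains (V n) (node e) := by
    intro n hn e he
    refine skip (h - 1) le_rfl n hn e ?_
    have := hC (node e) (by simp) he
    by_cases h2 : d = 2
    · rw [hV₂ h2]; exact this
    · obtain ⟨L, R, hVn, -⟩ := hV₃ h2
      rw [hVn]
      exact vertebra_skip hd (Or.inl this)
  -- Simultaneous induction on the size. A root with one child needs an edge from above `V n` when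
  -- exactly k - n vertices are present, hence `Reaches`; its subtree has one vertex fewer and falls
  -- under the second claim. The side condition in the first claim excludes d = 2, n = h - 1, where
  -- no vertebra is left. A leaf counts as `only b empty`.
  have main : ∀ N, ∀ e n, (node e).size = N → n ≤ h - 1 → N ≤ k - n →
      ((¬ ∃ b t, e = only b t) → (n ≤ h - 2 ∨ d ≠ 2 ∨ N ≤ k - h) → NonContains (V n) (node e)) ∧
      (N ≤ k - n - 1 → NonContains (V n) (node e)) ∧
      ((∃ b t, e = only b t) → Reaches (List.finRange d) (V n) e) := by
    intro N
    induction N using Nat.strong_induction_on with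
    | _ N ih =>
    have reach : ∀ e n, (node e).size < N → n ≤ h - 1 → (node e).size ≤ k - n →
        ((∃ b t, e = only b t) ∨ n ≤ h - 2 ∨ d ≠ 2 ∨ (node e).size ≤ k - h) →
        Reaches (List.finRange d) (V n) e := by
      intro e n h1 h2 h3 h4
      obtain ⟨i1, -, i3⟩ := ih _ h1 e n rfl h2 h3
      by_cases hs : ∃ b t, e = only b t
      · exact i3 hs
      · exact Or.inl (i1 hs (h4.resolve_left hs))
    have single_reach : ∀ e n, (node e).size = N → n ≤ h - 1 → N ≤ k - n →
        (∃ b t, e = only b t) → Reaches (List.finRange d) (V n) e := by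
      rintro e n hN hn hNk ⟨b, t, rfl⟩
      by_cases ht : t = empty
      · refine Or.inl (center n hn _ ?_)
        rw [size_only, ht]
        simp only [size]
        omega
      · refine Or.inr ⟨b, List.mem_finRange b, t, ht, rfl, ?_⟩
        rw [size_only] at hN
        obtain ⟨e, rfl⟩ := exists_eq_node ht
        exact (ih _ (by omega) e n rfl hn (by omega)).2.1 (by omega)
    have multi : ∀ e n, (node e).size = N → n ≤ h - 1 → N ≤ k - n →
        (¬ ∃ b t, e = only b t) → (n ≤ h - 2 ∨ d ≠ 2 ∨ N ≤ k - h) →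
        NonContains (V n) (node e) := by
      intro e n hN hn hNk hs hcond
      by_cases hNK : N ≤ k - h
      · exact center n hn e (hN ▸ hNK)
      by_cases hleaf : ∃ j, e j ≠ empty
      swap
      · push Not at hleaf
        refine absurd ⟨⟨0, by omega⟩, empty, ?_⟩ hs
        funext j
        simp [hleaf, only]
      obtain ⟨j, hj⟩ := hleaf
      obtain ⟨a, c, hac, ha, hc, hext⟩ := exists_extreme_children hj hs
      have hsz := size_two_children_le e hac.ne
      have hsa := size_pos ha
      have hsc := size_pos hc
      have hea := size_update_empty e a
      have hec := size_update_empty e c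
      -- For d = 2 the remainder has a single child, so the third claim applies to it even at n = h
      -- - 1. This is why d = 2 needs one vertebra fewer.
      have two : ∀ x y, x ≠ y → d = 2 → Function.update e x empty = only y (e y) := by
        intro x y hxy h2
        funext i
        by_cases hi : i = x
        · subst hi
          rw [only_of_ne hxy]; simp
        · have : i = y := by
            ext
            have := x.2; have := y.2; have := i.2
            have h1 : (i : ℕ) ≠ x := fun h => hi (Fin.ext h)
            have h2 : (x : ℕ) ≠ y := fun h => hxy (Fin.ext h)
            omega
          subst this
          rw [Function.update_of_ne hi, only_self]
      have rest : ∀ x y m, x ≠ y → 1 ≤ (e x).size → m ≤ h - 1 →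
          (node (Function.update e x empty)).size ≤ k - m →
          Reaches (List.finRange d) (V m) (Function.update e x empty) := by
        intro x y m hxy hx hm hle
        have := size_update_empty e x
        refine reach _ m (by omega) hm hle ?_
        by_cases h2 : d = 2
        · exact Or.inl ⟨y, e y, two x y hxy h2⟩
        · exact Or.inr (Or.inr (Or.inl h2))
      by_cases hn2 : n ≤ h - 2
      · by_cases hle : (e a).size ≤ (e c).size
        -- With m the size of the smaller extreme child, vertebra n + m - 1 has leaves covering n +
        -- m ≥ m vertices, and the remainder has at most k - (n + m). If that vertebra is too low,
        -- then m ≥ h - n and the remainder fits the center leaf.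
        · by_cases hslot : n + (e a).size ≤ h - 1
          · obtain ⟨L, R, hVm, hL, hR, -⟩ := hV (n + (e a).size - 1) (by omega)
            refine skip (n + (e a).size - 1) (by omega) n (by omega) e ?_
            rw [Nat.sub_add_cancel (by omega)] at hVm hL
            rw [hVm]
            exact vertebra_peel hd hac ha hc hext (Or.inl ⟨hle, hL _ ha (by omega),
              rest a c _ hac.ne hsa hslot (by omega)⟩)
          -- From 1 + 2m ≤ k follows m ≤ k - h - 1, the capacity of this left leaf.
          · obtain ⟨L, R, hVm, -, -, hL⟩ := hV (h - 2) (by omega)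
            refine skip (h - 2) (by omega) n (by omega) e ?_
            rw [hVm, show h - 2 + 1 = h - 1 by omega]
            exact vertebra_peel hd hac ha hc hext (Or.inl ⟨hle, hL (by omega) _ ha (by omega),
              Or.inl (center _ le_rfl _ (by omega))⟩)
        · by_cases hslot : n + (e c).size ≤ h - 1
          · obtain ⟨L, R, hVm, hL, hR, -⟩ := hV (n + (e c).size - 1) (by omega)
            refine skip (n + (e c).size - 1) (by omega) n (by omega) e ?_
            rw [Nat.sub_add_cancel (by omega)] at hVm hR
            rw [hVm]
            exact vertebra_peel hd hac ha hc hext (Or.inr ⟨by omega, hR _ hc (by omega),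
              rest c a _ hac.ne' hsc hslot (by omega)⟩)
          -- Ties go to the left, so here 2m + 2 ≤ k and m ≤ h - 1: the right leaf may be smaller.
          · obtain ⟨L, R, hVm, -, hR, -⟩ := hV (h - 2) (by omega)
            refine skip (h - 2) (by omega) n (by omega) e ?_
            rw [hVm]
            rw [show h - 2 + 1 = h - 1 by omega] at hR ⊢
            exact vertebra_peel hd hac ha hc hext (Or.inr ⟨by omega, hR _ hc (by omega),
              Or.inl (center _ le_rfl _ (by omega))⟩)
      · have hd2 : d ≠ 2 := by
          rcases hcond with h | h | h
          · exact absurd h hn2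
          · exact h
          · exact absurd h hNK
        obtain ⟨L, R, hVm, hL, hR⟩ := hV₃ hd2
        -- Now N = k - h + 1, so the smaller child has at most (k - h) / 2 vertices and the
        -- remainder at most k - h.
        have : n = h - 1 := by omega
        subst this
        rw [hVm]
        by_cases hle : (e a).size ≤ (e c).size
        · exact vertebra_peel hd hac ha hc hext (Or.inl ⟨hle, hL _ ha (by omega),
            Or.inl (hC _ (by simp) (by omega))⟩)
        · exact vertebra_peel hd hac ha hc hext (Or.inr ⟨by omega, hR _ hc (by omega),
            Or.inl (hC _ (by simp) (by omega))⟩)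
    intro e n hN hn hNk
    refine ⟨multi e n hN hn hNk, fun hlt => ?_, single_reach e n hN hn hNk⟩
    by_cases hNK : N ≤ k - h
    · exact center n hn e (hN ▸ hNK)
    by_cases hs : ∃ b t, e = only b t
    -- The crescent through vertebra n supplies the single edge above `V (n + 1)`.
    · obtain ⟨L, R, hVn, -⟩ := hV n (by omega)
      rw [hVn]
      exact vertebra_skip hd (single_reach e (n + 1) hN (by omega) (by omega) hs)
    · exact multi e n hN hn hNk hs (Or.inl (by omega))
  intro t ht hts
  obtain ⟨e, rfl⟩ := exists_eq_node ht
  obtain ⟨m1, -, m3⟩ := main _ e 0 rfl (Nat.zero_le _) hts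
  refine Reaches.path (l := List.finRange d) ?_
  by_cases hs : ∃ b t, e = only b t
  · exact m3 hs
  · exact Or.inl (m1 hs (Or.inl (Nat.zero_le _)))

lemma eq_single_of_size_le_one {t : DAryTree d} (ht : t ≠ empty) (h : t.size ≤ 1) : t = single := by
  obtain ⟨e, rfl⟩ := exists_eq_node ht
  unfold single
  congr 1
  funext j
  by_contra hj
  have := size_child_le e j
  have := size_pos hj
  omega

lemma eq_only_of_size_le {e : Fin d → DAryTree d} {j : Fin d}
    (h : (node e).size ≤ 1 + (e j).size) : e = only j (e j) := by
  funext i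
  by_cases hi : i = j
  · subst hi; simp
  · rw [only_of_ne hi]
    by_contra hne
    have := size_two_children_le e hi
    have := size_pos hne
    omega

lemma covers_single : Covers 1 (single : DAryTree d) := by
  intro t ht h
  rw [eq_single_of_size_le_one ht h]
  exact .refl _

lemma Reaches.of_size_le {C : DAryTree d} {e : Fin d → DAryTree d} {j : Fin d} {s : ℕ}
    (hC : Covers s C) (hj : e j ≠ empty) (h : (node e).size ≤ 1 + (e j).size)
    (hs : (node e).size ≤ s + 1) : Reaches (List.finRange d) C e := by
  have := size_child_le e j
  exact Or.inr ⟨j, List.mem_finRange j, e j, hj, eq_only_of_size_le h, hC _ hj (by omega)⟩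

lemma covers_crescent_single : Covers 2 (crescent (single : DAryTree d)) := by
  intro t ht h
  obtain ⟨e, rfl⟩ := exists_eq_node ht
  refine Reaches.path (l := List.finRange d) ?_
  by_cases hj : ∃ j, e j ≠ empty
  · obtain ⟨j, hj⟩ := hj
    have := size_pos hj
    exact .of_size_le covers_single hj (by omega) h
  · push Not at hj
    refine Or.inl (.of_eq ?_)
    unfold single
    congr 1
    funext j
    rw [hj]

/-- A tree with at most three vertices either has only leaves below its root or is a path, whose top
edge comes from the crescent. -/
lemma covers_crescent_star : Covers 3 (crescent (node fun _ => (single : DAryTree d))) := by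
  have star : ∀ e : Fin d → DAryTree d, (∀ j, (e j).size ≤ 1) →
      NonContains (node fun _ => (single : DAryTree d)) (node e) := by
    intro e he
    refine NonContains.children fun j => ?_
    by_cases hj : e j = empty
    · exact Or.inl hj
    · exact Or.inr (covers_single _ hj (he j))
  have hstar : Covers 2 (node fun _ => (single : DAryTree d)) := by
    intro t ht h
    obtain ⟨e, rfl⟩ := exists_eq_node ht
    refine star e fun j => ?_
    have := size_child_le e j
    omega
  intro t ht h
  obtain ⟨e, rfl⟩ := exists_eq_node ht
  refine Reaches.path (l := List.finRange d) ?_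
  by_cases hj : ∀ j, (e j).size ≤ 1
  · exact Or.inl (star e hj)
  · push Not at hj
    obtain ⟨j, hj⟩ := hj
    exact .of_size_le hstar (ne_empty_of_size_pos hj.le) (by omega) h

/-- The pairs of trees glued to the left and right leaves of the spine in `xi d k`, `k ≥ 4`. -/
def xiSides (d k : ℕ) : List (DAryTree d × DAryTree d) :=
  List.ofFn (fun i : Fin (k / 2 - 2) => (xi d (i.val + 1), xi d (i.val + 1)))
    ++ [(xi d ((k + 1) / 2 - 1), xi d (k / 2 - 1))]
    ++ if d = 2 then [] else [(xi d ((k + 1) / 4), xi d ((k + 1) / 4))]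

lemma xi_eq_spine {k : ℕ} (hk : 4 ≤ k) : xi d k = spine (xiSides d k) (xi d ((k + 1) / 2)) := by
  obtain ⟨n, rfl⟩ := Nat.exists_eq_add_of_le' hk
  rw [xi]
  rfl

theorem covers_xi (hd : 2 ≤ d) (k : ℕ) (hk : 1 ≤ k) : Covers k (xi d k) := by
  induction k using Nat.strong_induction_on with
  | _ k ih =>
  by_cases h4 : 4 ≤ k
  swap
  · interval_cases k
    · rw [xi]; exact covers_single
    · rw [xi]; exact covers_crescent_single
    · rw [xi]; exact covers_crescent_star
  rw [xi_eq_spine h4]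
  have hlen : (List.ofFn (fun i : Fin (k / 2 - 2) =>
      (xi d (i.val + 1), xi d (i.val + 1)))).length = k / 2 - 2 := by simp
  refine covers_crescent_of_chain hd (h := k / 2) (by omega) (by omega)
    (fun n => ((xiSides d k).drop n).foldr (fun p s => vertebra p.1 s p.2) (xi d ((k + 1) / 2)))
    (xi d ((k + 1) / 2)) ?_ ?_ ?_ ?_
  · intro n hn
    by_cases hn2 : n < k / 2 - 2
    · refine ⟨xi d (n + 1), xi d (n + 1), ?_, ih _ (by omega) (by omega), ih _ (by omega) (by omega),
        fun h => by omega⟩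
      have hlt : n < (xiSides d k).length := by
        simp only [xiSides, List.length_append, hlen]; omega
      have hget : (xiSides d k)[n] = (xi d (n + 1), xi d (n + 1)) := by
        simp [xiSides, hn2]
      rw [List.drop_eq_getElem_cons hlt, hget]
      rfl
    · obtain rfl : n = k / 2 - 2 := by omega
      refine ⟨xi d ((k + 1) / 2 - 1), xi d (k / 2 - 1), ?_,
        (ih _ (by omega) (by omega)).mono (by omega), (ih _ (by omega) (by omega)).mono (by omega),
        fun _ => (ih _ (by omega) (by omega)).mono (by omega)⟩
      simp only [xiSides, List.append_assoc]
      rw [List.drop_left' hlen, ← List.drop_drop, List.drop_left' hlen]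
      rfl
  · exact (ih _ (by omega) (by omega)).mono (by omega)
  · intro h2
    have : (xiSides d k).drop (k / 2 - 1) = [] := by
      rw [List.drop_eq_nil_iff]
      simp only [xiSides, List.length_append, hlen, h2]
      simp
      omega
    simp only [this, List.foldr_nil]
  · intro h2
    refine ⟨xi d ((k + 1) / 4), xi d ((k + 1) / 4), ?_, (ih _ (by omega) (by omega)).mono (by omega),
      (ih _ (by omega) (by omega)).mono (by omega)⟩
    have : (xiSides d k).drop (k / 2 - 1) = [(xi d ((k + 1) / 4), xi d ((k + 1) / 4))] := by
      simp only [xiSides, h2, if_false]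
      refine List.drop_left' ?_
      simp only [List.length_append, hlen]
      simp
      omega
    simp only [this, List.foldr_cons, List.foldr_nil]

theorem nNon_le_xiSize (hd : 2 ≤ d) {k : ℕ} (hk : 1 ≤ k) : nNon d k ≤ (xiSize d k : ℕ∞) :=
  iInf₂_le (xi d k) fun (S : DAryTree d) (hS : S.size = k) =>
    covers_xi hd k hk S (ne_empty_of_size_pos (hk.trans hS.ge)) hS.le

end DAryTree

/-! ### Growth of the number of vertices -/

namespace DAryTree

variable {d : ℕ}

lemma size_path (l : List (Fin d)) (t : DAryTree d) : (path l t).size = l.length + t.size := by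
  induction l with
  | nil => simp [path]
  | cons i l ih => rw [path_cons, size_only, ih, List.length_cons]; omega

lemma size_single : (single : DAryTree d).size = 1 := by simp [single, size]

lemma size_crescent (t : DAryTree d) : (crescent t).size = d + t.size := by
  simp [crescent, size_path]

lemma size_glueRoot_le (s t : DAryTree d) : (glueRoot s t).size ≤ s.size + t.size := by
  cases s with
  | empty => simp [glueRoot, size]
  | node c =>
    cases t with
    | empty => simp [glueRoot, size]
    | node c' =>
      simp only [glueRoot, size_node]
      refine le_trans (Nat.add_le_add_left (Finset.sum_le_sum
        (g := fun i => (c i).size + (c' i).size) fun i _ => ?_) 1) ?_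
      · cases c i <;> simp [size]
      · rw [Finset.sum_add_distrib]
        omega

lemma size_vertebra_le (L C R : DAryTree d) :
    (vertebra L C R).size ≤ L.size + C.size + R.size + 3 * d := by
  unfold vertebra
  refine (size_glueRoot_le _ _).trans ?_
  rw [size_path, size_path]
  have := size_glueRoot_le (path (List.finRange d).dropLast L) (path (List.finRange d).tail C)
  rw [size_path, size_path] at this
  simp only [List.length_take, List.length_dropLast, List.length_tail, List.length_finRange] at *
  omega

lemma le_size_vertebra (hd : 2 ≤ d) (L C R : DAryTree d) :
    L.size + C.size + R.size ≤ (vertebra L C R).size := by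
  obtain ⟨n, rfl⟩ := Nat.exists_eq_add_of_le' hd
  obtain ⟨l₁, l₂, -, -, h⟩ := exists_vertebra_eq n
  rw [h]
  refine le_trans ?_ (size_two_children_le _ (zero_ne_one (α := Fin (n + 2))))
  have := size_two_children_le (fun j : Fin (n + 2) => if j = 0 then path l₁ L
    else if j = 1 then path l₂ C else empty) (zero_ne_one (α := Fin (n + 2)))
  simp only [if_true, one_ne_zero, if_false, size_path] at this ⊢
  omega

lemma size_foldr_vertebra_le (l : List (DAryTree d × DAryTree d)) (C : DAryTree d) {G : ℝ}
    (h : ∀ p ∈ l, (p.1.size : ℝ) ≤ G ∧ (p.2.size : ℝ) ≤ G) :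
    ((l.foldr (fun p s => vertebra p.1 s p.2) C).size : ℝ) ≤ l.length * (2 * G + 3 * d) + C.size := by
  induction l with
  | nil => simp
  | cons p l ih =>
    have h1 := ih fun q hq => h q (List.mem_cons_of_mem _ hq)
    obtain ⟨h2, h3⟩ := h p List.mem_cons_self
    have h4 : ((vertebra p.1 (l.foldr (fun p s => vertebra p.1 s p.2) C) p.2).size : ℝ) ≤
      p.1.size + (l.foldr (fun p s => vertebra p.1 s p.2) C).size + p.2.size + 3 * d := by
      exact_mod_cast size_vertebra_le _ _ _
    simp only [List.foldr_cons, List.length_cons]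
    push_cast
    linarith

lemma le_size_foldr_vertebra (hd : 2 ≤ d) (l : List (DAryTree d × DAryTree d)) (C : DAryTree d) :
    (l.map fun p => p.1.size + p.2.size).sum ≤
      (l.foldr (fun p s => vertebra p.1 s p.2) C).size := by
  induction l with
  | nil => simp
  | cons p l ih =>
    have := le_size_vertebra hd p.1 (l.foldr (fun p s => vertebra p.1 s p.2) C) p.2
    simp only [List.foldr_cons, List.map_cons, List.sum_cons]
    omega

lemma length_xiSides_le {k : ℕ} (hk : 4 ≤ k) : (xiSides d k).length ≤ k / 2 := by
  by_cases h2 : d = 2 <;> simp [xiSides, h2] <;> omega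

lemma xiSides_mem {k : ℕ} (hk : 4 ≤ k) {p : DAryTree d × DAryTree d} (hp : p ∈ xiSides d k) :
    ∃ i j, 1 ≤ i ∧ i ≤ (k + 1) / 2 ∧ 1 ≤ j ∧ j ≤ (k + 1) / 2 ∧ p = (xi d i, xi d j) := by
  simp only [xiSides, List.mem_append, List.mem_ofFn, List.mem_singleton] at hp
  rcases hp with (⟨i, rfl⟩ | rfl) | hp
  · have := i.2
    exact ⟨i + 1, i + 1, by omega, by omega, by omega, by omega, rfl⟩
  · exact ⟨_, _, by omega, by omega, by omega, by omega, rfl⟩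
  · by_cases h2 : d = 2
    · simp [h2] at hp
    · simp only [h2, if_false, List.mem_singleton] at hp
      exact ⟨_, _, by omega, by omega, by omega, by omega, hp⟩

lemma xiSize_le_mul (hd : 2 ≤ d) {k : ℕ} (hk : 4 ≤ k) {G : ℝ} (hG : 1 ≤ G)
    (h : ∀ i, 1 ≤ i → i ≤ (k + 1) / 2 → (xiSize d i : ℝ) ≤ G) :
    (xiSize d k : ℝ) ≤ 4 * d * k * G := by
  have h1 := size_foldr_vertebra_le (xiSides d k) (xi d ((k + 1) / 2)) (G := G) (by
    intro p hp
    obtain ⟨i, j, hi, hi', hj, hj', rfl⟩ := xiSides_mem hk hp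
    exact ⟨h i hi hi', h j hj hj'⟩)
  have h2 := h ((k + 1) / 2) (by omega) le_rfl
  have h3 : ((xiSides d k).length : ℝ) ≤ k / 2 := by
    have : 2 * (xiSides d k).length ≤ k := by
      have := length_xiSides_le (d := d) hk
      omega
    have : (2 * (xiSides d k).length : ℝ) ≤ k := by exact_mod_cast this
    linarith
  have hd' : (2 : ℝ) ≤ d := by exact_mod_cast hd
  have hk' : (4 : ℝ) ≤ k := by exact_mod_cast hk
  have h4 : (xiSize d k : ℝ) = d + (((xiSides d k).foldr (fun p s => vertebra p.1 s p.2)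
      (xi d ((k + 1) / 2))).size : ℝ) := by
    rw [xiSize, xi_eq_spine hk, spine, size_crescent]
    push_cast
    rfl
  have h5 : ((xiSides d k).length : ℝ) * (2 * G + 3 * d) ≤ k / 2 * (2 * G + 3 * d) :=
    mul_le_mul_of_nonneg_right h3 (by positivity)
  rw [xiSize] at h2
  have h6 : (d : ℝ) ≤ d * G := by nlinarith
  have h7 : (k : ℝ) * d ≤ k * d * G := by
    have : 0 ≤ (k : ℝ) * d := by positivity
    nlinarith
  have h8 : k * G * 2 ≤ k * G * d := mul_le_mul_of_nonneg_left hd' (by positivity)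
  have h9 : 4 * (d * G) ≤ k * (d * G) := mul_le_mul_of_nonneg_right hk' (by positivity)
  have h10 : 2 * G ≤ d * G := mul_le_mul_of_nonneg_right hd' (by positivity)
  nlinarith

lemma mul_le_xiSize (hd : 2 ≤ d) {k j : ℕ} (hk : 4 ≤ k) {G : ℝ} (hG : 0 ≤ G)
    (h : ∀ i, j < i → i ≤ k / 2 - 2 → G ≤ xiSize d i) :
    (((k / 2 - 2 : ℕ) : ℝ) - j) * (2 * G) ≤ xiSize d k := by
  have h1 := le_size_foldr_vertebra hd (xiSides d k) (xi d ((k + 1) / 2))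
  have h2 : ∑ i ∈ Finset.range (k / 2 - 2), 2 * xiSize d (i + 1) ≤ xiSize d k := by
    have h3 : ∑ i ∈ Finset.range (k / 2 - 2), 2 * xiSize d (i + 1) =
        ((List.ofFn (fun i : Fin (k / 2 - 2) => (xi d (i.val + 1), xi d (i.val + 1)))).map
          fun p => p.1.size + p.2.size).sum := by
      rw [List.map_ofFn, List.sum_ofFn,
        Finset.sum_range fun i => 2 * xiSize d (i + 1)]
      refine Finset.sum_congr rfl fun i _ => ?_
      simp [xiSize, two_mul]
    rw [h3, xiSize, xi_eq_spine hk, spine, size_crescent]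
    simp only [xiSides, List.map_append, List.sum_append] at h1 ⊢
    omega
  have h4 : (∑ i ∈ Finset.range (k / 2 - 2), 2 * (xiSize d (i + 1) : ℝ)) ≤ xiSize d k := by
    exact_mod_cast h2
  refine le_trans ?_ h4
  refine le_trans ?_ (Finset.sum_le_sum_of_subset_of_nonneg
    (s := Finset.Ico j (k / 2 - 2)) (fun i hi => ?_) fun i _ _ => by positivity)
  · have h5 := Finset.card_nsmul_le_sum (Finset.Ico j (k / 2 - 2))
      (fun i => 2 * (xiSize d (i + 1) : ℝ)) (2 * G) (fun i hi => by
        rw [Finset.mem_Ico] at hi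
        have := h (i + 1) (by omega) (by omega)
        linarith)
    refine le_trans ?_ h5
    rw [Nat.card_Ico, nsmul_eq_mul]
    refine mul_le_mul_of_nonneg_right ?_ (by positivity)
    rw [sub_le_iff_le_add]
    exact_mod_cast (by omega : k / 2 - 2 ≤ k / 2 - 2 - j + j)
  · rw [Finset.mem_Ico] at hi
    exact Finset.mem_range.2 hi.2

lemma xiSize_one : xiSize d 1 = 1 := by rw [xiSize, xi, size_single]

lemma xiSize_two : xiSize d 2 = d + 1 := by rw [xiSize, xi, size_crescent, size_single]

lemma xiSize_three : xiSize d 3 = 2 * d + 1 := by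
  rw [xiSize, xi, size_crescent, size_node]
  simp [size_single]
  omega

lemma one_le_xiSize (hd : 2 ≤ d) {k : ℕ} (hk : 1 ≤ k) : 1 ≤ xiSize d k :=
  size_pos ((covers_xi hd k hk single (by simp [single]) (by rwa [size_single])).ne_empty
    (by simp [single]))

/-- With f(y) = y²/2 + By + A, the choice of B gives f(y) - f(y - 1) = y + log₂(8d), which absorbs
the factor 4dk of `xiSize_le_mul`. A covers k ≤ 3. -/
theorem exists_xiSize_le_rpow (hd : 2 ≤ d) : ∃ A B : ℝ, 0 ≤ A ∧ 0 ≤ B ∧ ∀ k : ℕ, 1 ≤ k →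
    (xiSize d k : ℝ) ≤ 2 ^ (1 / 2 * Real.logb 2 k ^ 2 + B * Real.logb 2 k + A) := by
  have hd' : (2 : ℝ) ≤ d := by exact_mod_cast hd
  set A := Real.logb 2 (2 * d + 1) with hA
  set B := Real.logb 2 (8 * d) + 1 / 2 with hB
  have hA0 : 0 ≤ A := Real.logb_nonneg one_lt_two (by linarith)
  have hB0 : 0 ≤ B := add_nonneg (Real.logb_nonneg one_lt_two (by linarith)) (by norm_num)
  have mono : ∀ x y : ℝ, 0 ≤ x → x ≤ y →
      1 / 2 * x ^ 2 + B * x + A ≤ 1 / 2 * y ^ 2 + B * y + A := by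
    intro x y hx hxy
    have := mul_le_mul_of_nonneg_left hxy hB0
    nlinarith
  have hlog0 : ∀ n : ℕ, 0 ≤ Real.logb 2 (n : ℝ) := by
    intro n
    rcases Nat.eq_zero_or_pos n with rfl | hn
    · simp
    · exact Real.logb_nonneg one_lt_two (by exact_mod_cast hn)
  -- Using k - 1 avoids rounding: i ≤ ⌈k/2⌉ gives i - 1 ≤ (k - 1)/2, an exact halving. At k = 1 the
  -- default `logb 2 0 = 0` is harmless.
  have hsharp : ∀ k : ℕ, 1 ≤ k → (xiSize d k : ℝ) ≤
      2 ^ (1 / 2 * Real.logb 2 ((k - 1 : ℕ) : ℝ) ^ 2 + B * Real.logb 2 ((k - 1 : ℕ) : ℝ) + A) := by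
    intro k
    induction k using Nat.strong_induction_on with
    | _ k ih =>
    intro hk
    by_cases h4 : 4 ≤ k
    swap
    · have h1 : (xiSize d k : ℝ) ≤ 2 * d + 1 := by
        have : k = 1 ∨ k = 2 ∨ k = 3 := by omega
        rcases this with rfl | rfl | rfl
        · rw [xiSize_one]; push_cast; linarith
        · rw [xiSize_two]; push_cast; linarith
        · rw [xiSize_three]; push_cast; linarith
      refine h1.trans ?_
      have h2 : (2 : ℝ) ^ A = 2 * d + 1 :=
        Real.rpow_logb two_pos (by norm_num) (by positivity)
      rw [← h2]
      refine Real.rpow_le_rpow_of_exponent_le one_le_two ?_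
      simpa using mono 0 _ le_rfl (hlog0 (k - 1))
    · set y := Real.logb 2 ((k - 1 : ℕ) : ℝ) with hy
      have hk1 : (3 : ℝ) ≤ ((k - 1 : ℕ) : ℝ) := by exact_mod_cast (by omega : 3 ≤ k - 1)
      have hy1 : 1 ≤ y := by
        rw [hy, Real.le_logb_iff_rpow_le one_lt_two (by linarith), Real.rpow_one]
        linarith
      have hstep := xiSize_le_mul hd h4
        (G := 2 ^ (1 / 2 * (y - 1) ^ 2 + B * (y - 1) + A)) ?_ ?_
      · refine hstep.trans ?_
        have hkk : (k : ℝ) = ((k - 1 : ℕ) : ℝ) + 1 := by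
          rw [Nat.cast_sub (by omega)]; simp
        have h2y : (2 : ℝ) ^ y = ((k - 1 : ℕ) : ℝ) :=
          Real.rpow_logb two_pos (by norm_num) (by linarith)
        have h2d : (2 : ℝ) ^ (Real.logb 2 (8 * d)) = 8 * d :=
          Real.rpow_logb two_pos (by norm_num) (by linarith)
        have hexp : 1 / 2 * y ^ 2 + B * y + A =
            Real.logb 2 (8 * d) + y + (1 / 2 * (y - 1) ^ 2 + B * (y - 1) + A) := by
          rw [hB]; ring
        rw [hexp]
        generalize 1 / 2 * (y - 1) ^ 2 + B * (y - 1) + A = E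
        rw [Real.rpow_add two_pos, Real.rpow_add two_pos, h2y, h2d]
        refine mul_le_mul_of_nonneg_right ?_ (by positivity)
        rw [hkk]
        nlinarith
      · exact Real.one_le_rpow one_le_two (by
          have := mul_nonneg hB0 (sub_nonneg.2 hy1)
          positivity)
      · intro i hi hik
        refine (ih i (by omega) hi).trans (Real.rpow_le_rpow_of_exponent_le one_le_two
          (mono _ _ (hlog0 _) ?_))
        rcases Nat.eq_zero_or_pos (i - 1) with h0 | h0
        · rw [h0]; simpa using hy1
        · have h1 : y - 1 = Real.logb 2 (((k - 1 : ℕ) : ℝ) / 2) := by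
            rw [Real.logb_div (by linarith) two_ne_zero, Real.logb_self_eq_one one_lt_two]
          rw [h1]
          refine Real.logb_le_logb_of_le one_lt_two (by exact_mod_cast h0) ?_
          rw [le_div_iff₀ two_pos]
          exact_mod_cast (by omega : (i - 1) * 2 ≤ k - 1)
  refine ⟨A, B, hA0, hB0, fun k hk => (hsharp k hk).trans
    (Real.rpow_le_rpow_of_exponent_le one_le_two (mono _ _ (hlog0 _) ?_))⟩
  rcases Nat.eq_zero_or_pos (k - 1) with h0 | h0
  · rw [h0]; simpa using hlog0 k
  · exact Real.logb_le_logb_of_le one_lt_two (by exact_mod_cast h0)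
      (by exact_mod_cast Nat.sub_le k 1)

/-- With f(y) = αy²/2 - By, shifting y by 1/α, that is, dividing k by ρ = 2^(1/α) > 2, changes f by
y - 1/(2α) - B/α. The indices from k/ρ to k/2 - 2 number at least ck, so `mul_le_xiSize` gains a
factor 2ck, and B is large enough to absorb log₂(2c). -/
theorem exists_rpow_le_xiSize (hd : 2 ≤ d) {α : ℝ} (hα : 0 < α) (hα1 : α < 1) :
    ∃ B : ℝ, ∀ k : ℕ, 1 ≤ k →
      (2 : ℝ) ^ (α / 2 * Real.logb 2 k ^ 2 - B * Real.logb 2 k) ≤ xiSize d k := by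
  have hinv : 1 < 1 / α := by rw [lt_div_iff₀ hα]; linarith
  have hρ : (2 : ℝ) < 2 ^ (1 / α) := by
    have := Real.rpow_lt_rpow_of_exponent_lt one_lt_two hinv
    simpa using this
  set ρ : ℝ := 2 ^ (1 / α) with hρdef
  have hρ0 : 0 < ρ := by linarith
  set c : ℝ := (1 / 2 - 1 / ρ) / 2 with hc
  have hc0 : 0 < c := by
    have : 1 / ρ < 1 / 2 := one_div_lt_one_div_of_lt two_pos hρ
    rw [hc]; linarith
  set B : ℝ := 1 + |Real.logb 2 (2 * c)| + |Real.logb 2 (4 / c + 4)| with hB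
  have hB1 : 1 ≤ B := by
    have := abs_nonneg (Real.logb 2 (2 * c))
    have := abs_nonneg (Real.logb 2 (4 / c + 4))
    linarith
  have hBc : -Real.logb 2 (2 * c) ≤ B := by
    have := neg_le_abs (Real.logb 2 (2 * c))
    have := abs_nonneg (Real.logb 2 (4 / c + 4))
    linarith
  have hBK : Real.logb 2 (4 / c + 4) ≤ B := by
    have := abs_nonneg (Real.logb 2 (2 * c))
    have := le_abs_self (Real.logb 2 (4 / c + 4))
    linarith
  have hBα : B ≤ B / α := by
    rw [le_div_iff₀ hα]; nlinarith
  refine ⟨B, fun k => ?_⟩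
  induction k using Nat.strong_induction_on with
  | _ k ih =>
  intro hk
  have hk0 : (0 : ℝ) < k := by exact_mod_cast hk
  set y := Real.logb 2 (k : ℝ) with hy
  have hy0 : 0 ≤ y := Real.logb_nonneg one_lt_two (by exact_mod_cast hk)
  have h2y : (2 : ℝ) ^ y = k := Real.rpow_logb two_pos (by norm_num) hk0
  -- In this range the exponent is nonpositive. Beyond it y - 1/α ≥ B/α, where f is increasing, and
  -- ck ≥ 4 absorbs the rounding losses.
  by_cases hsmall : y ≤ 2 * B / α
  · have h1 : α / 2 * y ^ 2 - B * y ≤ 0 := by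
      rw [le_div_iff₀ hα] at hsmall
      nlinarith
    have h2 : (1 : ℝ) ≤ xiSize d k := by exact_mod_cast one_le_xiSize hd hk
    exact (Real.rpow_le_one_of_one_le_of_nonpos one_le_two h1).trans h2
  push Not at hsmall
  have h2B : 2 * B / α = 2 * (B / α) := by ring
  have hyB : B ≤ y := by linarith
  have hkK : 4 / c + 4 ≤ k := by
    have := (Real.logb_le_logb one_lt_two (by positivity) hk0).1 (hBK.trans hyB)
    exact this
  have hk4 : 4 ≤ k := by
    have : (4 : ℝ) ≤ k := by
      have : 0 < 4 / c := by positivity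
      linarith
    exact_mod_cast this
  have hkc : 4 ≤ c * k := by
    have : 4 / c ≤ k := by linarith
    rw [div_le_iff₀ hc0] at this
    linarith
  set w := y - 1 / α with hw
  have hwB : B / α ≤ w := by
    have : 1 / α ≤ B / α := div_le_div_of_nonneg_right hB1 hα.le
    linarith
  have h2w : (2 : ℝ) ^ w = k / ρ := by
    rw [hw, Real.rpow_sub two_pos, h2y]
  have hstep := mul_le_xiSize hd (j := ⌈k / ρ⌉₊) hk4
    (G := 2 ^ (α / 2 * w ^ 2 - B * w)) (by positivity) ?_
  · refine le_trans ?_ hstep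
    have hexp : α / 2 * y ^ 2 - B * y =
        y + (α / 2 * w ^ 2 - B * w) - 1 / (2 * α) - B / α := by
      rw [hw]
      field_simp
      ring
    have hle : α / 2 * y ^ 2 - B * y ≤ Real.logb 2 (2 * c) + y + (α / 2 * w ^ 2 - B * w) := by
      have : 0 < 1 / (2 * α) := by positivity
      linarith
    refine (Real.rpow_le_rpow_of_exponent_le one_le_two hle).trans ?_
    rw [Real.rpow_add two_pos, Real.rpow_add two_pos, h2y,
      Real.rpow_logb two_pos (by norm_num) (by positivity)]
    have hceil : ((⌈k / ρ⌉₊ : ℕ) : ℝ) ≤ k / ρ + 1 := (Nat.ceil_lt_add_one (by positivity)).le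
    have hhalf : (k : ℝ) / 2 - 5 / 2 ≤ ((k / 2 - 2 : ℕ) : ℝ) := by
      have : k ≤ 2 * (k / 2 - 2) + 5 := by omega
      have : (k : ℝ) ≤ 2 * ((k / 2 - 2 : ℕ) : ℝ) + 5 := by exact_mod_cast this
      linarith
    have hck : 2 * (c * k) = k / 2 - k / ρ := by rw [hc]; ring
    have : c * k ≤ ((k / 2 - 2 : ℕ) : ℝ) - ⌈k / ρ⌉₊ := by linarith
    have := mul_le_mul_of_nonneg_right this
      (by positivity : (0 : ℝ) ≤ 2 * 2 ^ (α / 2 * w ^ 2 - B * w))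
    linarith
  · intro i hij hik
    have hi : (k : ℝ) / ρ ≤ i := (Nat.le_ceil _).trans (by exact_mod_cast hij.le)
    have hi0 : 0 < k / ρ := by positivity
    refine le_trans (Real.rpow_le_rpow_of_exponent_le one_le_two ?_) (ih i (by omega) (by omega))
    have hz : w ≤ Real.logb 2 (i : ℝ) := by
      rw [Real.le_logb_iff_rpow_le one_lt_two (by linarith), h2w]
      exact hi
    have hBw : B ≤ α * w := by
      rw [div_le_iff₀ hα] at hwB
      linarith
    -- This product is f(log₂ i) - f(w), factored.
    have : 0 ≤ (Real.logb 2 (i : ℝ) - w) * (α * (Real.logb 2 (i : ℝ) + w) / 2 - B) := by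
      refine mul_nonneg (sub_nonneg.2 hz) ?_
      have := mul_le_mul_of_nonneg_left hz hα.le
      linarith
    linarith

theorem tendsto_logb_xiSize_div (hd : 2 ≤ d) :
    Filter.Tendsto (fun k : ℕ => 2 * Real.logb 2 (xiSize d k : ℝ) / Real.logb 2 (k : ℝ) ^ 2)
      Filter.atTop (nhds 1) := by
  have hlog : Filter.Tendsto (fun k : ℕ => Real.logb 2 (k : ℝ)) Filter.atTop Filter.atTop :=
    (Real.tendsto_logb_atTop one_lt_two).comp tendsto_natCast_atTop_atTop
  have hinv := hlog.inv_tendsto_atTop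
  obtain ⟨A, B, -, -, hup⟩ := exists_xiSize_le_rpow hd
  have hM : ∀ k : ℕ, 1 ≤ k → (0 : ℝ) < xiSize d k := fun k hk => by
    exact_mod_cast one_le_xiSize hd hk
  rw [tendsto_order]
  constructor
  · intro a ha
    obtain ⟨α, hα, hα1⟩ := exists_between (max_lt ha zero_lt_one)
    obtain ⟨D, hlow⟩ := exists_rpow_le_xiSize hd ((le_max_right a 0).trans_lt hα) hα1
    have hlim : Filter.Tendsto (fun k : ℕ => α - 2 * D * (Real.logb 2 (k : ℝ))⁻¹)
        Filter.atTop (nhds (α - 2 * D * 0)) := tendsto_const_nhds.sub (hinv.const_mul _)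
    have hev := hlim.eventually (lt_mem_nhds (b := α - 2 * D * 0) (a := a)
      (by simpa using (le_max_left a 0).trans_lt hα))
    filter_upwards [hev, Filter.eventually_ge_atTop 1, hlog.eventually_gt_atTop 0] with k h1 hk hy
    refine h1.trans_le ?_
    have h2 := (Real.le_logb_iff_rpow_le one_lt_two (hM k hk)).2 (hlow k hk)
    rw [le_div_iff₀ (by positivity)]
    have : (α - 2 * D * (Real.logb 2 (k : ℝ))⁻¹) * Real.logb 2 (k : ℝ) ^ 2 =
        2 * (α / 2 * Real.logb 2 (k : ℝ) ^ 2 - D * Real.logb 2 (k : ℝ)) := by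
      field_simp
    rw [this]
    linarith
  · intro a ha
    have hlim : Filter.Tendsto (fun k : ℕ => 1 + 2 * B * (Real.logb 2 (k : ℝ))⁻¹ +
        2 * A * ((Real.logb 2 (k : ℝ))⁻¹ * (Real.logb 2 (k : ℝ))⁻¹))
        Filter.atTop (nhds (1 + 2 * B * 0 + 2 * A * (0 * 0))) :=
      (tendsto_const_nhds.add (hinv.const_mul _)).add ((hinv.mul hinv).const_mul _)
    have hev := hlim.eventually (gt_mem_nhds (show 1 + 2 * B * 0 + 2 * A * (0 * 0) < a
      by simpa using ha))
    filter_upwards [hev, Filter.eventually_ge_atTop 1, hlog.eventually_gt_atTop 0] with k h1 hk hy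
    refine lt_of_le_of_lt ?_ h1
    have h2 := (Real.logb_le_iff_le_rpow one_lt_two (hM k hk)).2 (hup k hk)
    rw [div_le_iff₀ (by positivity)]
    have : (1 + 2 * B * (Real.logb 2 (k : ℝ))⁻¹ +
        2 * A * ((Real.logb 2 (k : ℝ))⁻¹ * (Real.logb 2 (k : ℝ))⁻¹)) * Real.logb 2 (k : ℝ) ^ 2 =
        2 * (1 / 2 * Real.logb 2 (k : ℝ) ^ 2 + B * Real.logb 2 (k : ℝ) + A) := by
      field_simp
    rw [this]
    linarith

end DAryTree

theorem corollary2p7 (d : ℕ) (hd : 2 ≤ d) :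
    (∀ k : ℕ, 1 ≤ k → DAryTree.nNon d k ≤ (DAryTree.xiSize d k : ℕ∞)) ∧
    ∃ ε : ℕ → ℝ, Filter.Tendsto ε Filter.atTop (nhds 0) ∧
      ∀ k : ℕ, 1 ≤ k →
        (DAryTree.xiSize d k : ℝ) =
          (k : ℝ) ^ ((1 / 2 : ℝ) * Real.logb 2 (k : ℝ) * (1 + ε k)) := by
  refine ⟨fun k hk => DAryTree.nNon_le_xiSize hd hk,
    fun k => 2 * Real.logb 2 (DAryTree.xiSize d k : ℝ) / Real.logb 2 (k : ℝ) ^ 2 - 1, ?_, ?_⟩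
  · simpa using (DAryTree.tendsto_logb_xiSize_div hd).sub_const 1
  · intro k hk
    -- At k = 1 the quotient defining ε divides by zero, but both sides equal 1.
    rcases hk.eq_or_lt with rfl | hk1
    · simp [DAryTree.xiSize_one]
    have hM : (0 : ℝ) < DAryTree.xiSize d k := by
      exact_mod_cast DAryTree.one_le_xiSize hd hk
    have hk' : (1 : ℝ) < k := by exact_mod_cast hk1
    have hy : 0 < Real.logb 2 (k : ℝ) := Real.logb_pos one_lt_two hk'
    have h2y : (2 : ℝ) ^ Real.logb 2 (k : ℝ) = k :=
      Real.rpow_logb two_pos (by norm_num) (by linarith)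
    have hexp : Real.logb 2 (k : ℝ) * ((1 / 2 : ℝ) * Real.logb 2 (k : ℝ) *
        (1 + (2 * Real.logb 2 (DAryTree.xiSize d k : ℝ) / Real.logb 2 (k : ℝ) ^ 2 - 1))) =
        Real.logb 2 (DAryTree.xiSize d k : ℝ) := by
      field_simp
      ring
    beta_reduce
    generalize (1 / 2 : ℝ) * Real.logb 2 (k : ℝ) * (1 + (2 * Real.logb 2 (DAryTree.xiSize d k : ℝ) /
      Real.logb 2 (k : ℝ) ^ 2 - 1)) = E at hexp ⊢
    rw [← h2y, ← Real.rpow_mul two_pos.le, hexp, Real.rpow_logb two_pos (by norm_num) hM]
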